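/- A $\mathbb{Q}$-weighted automaton over a finite alphabet $\Sigma$ with finite state set $Q$ consists of a matrix $M(a)\in\mathbb{Q}^{Q\times Q}$ for every letter $a\in\Sigma$, an initial row vector $\alpha\in\mathbb{Q}^Q$ and a final column vector $\eta\in\mathbb{Q}^Q$; it assigns to a word $w=a_1\cdots a_k\in\Sigma^*$ the weight $\alpha M(a_1)\cdots M(a_k)\eta$. It is an image-binary finite automaton (IFA) if the weight of every word is $0$ or $1$; its language is then the set of words of weight $1$. Converting IFAs to nondeterministic finite automata (NFAs) requires a super-polynomial state blowup, even over a one-letter alphabet. Precisely: let $\Sigma$ be any nonempty finite alphabet. For every $c\in\mathbb{N}$ there is $n_0\in\mathbb{N}$ such that for every $n\ge n_0$ there is an IFA over $\Sigma$ with $n$ states such that every NFA over $\Sigma$ (with any number of initial states) that accepts the same language has more than $n^c$ states. -/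

import Mathlib

/-!
Over words read only through their length, a weighted automaton with `q` states tests whether `q`
divides the length, sums of weight functions add the numbers of states, and pointwise products
multiply them. Hence a polynomial of degree `e` in the indicators of non-divisibility by primes of
size about `P` costs about `P ^ e` states.

The polynomial `1 - (x + y + z) + (x y + y z + z x)` decides on `0`-`1` inputs whether they are all
equal. Iterated along a complete ternary tree of height `k` it has degree only `2 ^ k`, but it maps
the all-ones input to `1`, and to `0` as soon as any single one of the `3 ^ k` inputs is turned off.
Feed it the indicators for `3 ^ k` primes. A long word with length coprime to all the primes is
accepted, so an equivalent NFA can pump it by some positive length `l` at most its number of states.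
If one of the primes, `q`, did not divide `l`, pumping could reach a length divisible by `q` and by
no other of the primes, which must be rejected. So `l` is a multiple of the product of the primes,
which is of the order of `P ^ 3 ^ k`, while the weighted automaton has of the order of `P ^ 2 ^ k`
states.
-/

/-- A weighted automaton over the ring of weights `F`, with alphabet `A` and set of states `Q`:
a transition matrix for every letter, an initial row vector and a final column vector. -/
structure WeightedAutomaton (F A Q : Type*) where
  /-- The transition matrix of a letter. -/
  trans : A → Matrix Q Q F
  /-- The initial (row) vector. -/
  init : Q → F
  /-- The final (column) vector. -/
  final : Q → F

namespace WeightedAutomaton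

variable {F A Q : Type*} [Semiring F] [Fintype Q] [DecidableEq Q]

/-- The transition matrix of a word: the product, from left to right, of the matrices of its
letters (the identity matrix for the empty word). -/
def wordTrans (W : WeightedAutomaton F A Q) (w : List A) : Matrix Q Q F :=
  (w.map W.trans).prod

/-- The weight of a word: initial vector times transition matrix of the word times final vector. -/
def weight (W : WeightedAutomaton F A Q) (w : List A) : F :=
  W.init ⬝ᵥ (Matrix.mulVec (W.wordTrans w) W.final)

/-- A weighted automaton is image-binary if the weight of every word is `0` or `1`. -/
def IsImageBinary (W : WeightedAutomaton F A Q) : Prop :=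
  ∀ w : List A, W.weight w = 0 ∨ W.weight w = 1

/-- The set of the words of weight `1`. For an image-binary automaton this is the language
that it defines. -/
def accepts (W : WeightedAutomaton F A Q) : Language A :=
  {w : List A | W.weight w = 1}

end WeightedAutomaton

theorem dotProduct_mul_dotProduct {F Q Q' : Type*} [CommSemiring F] [Fintype Q] [Fintype Q']
    (u v : Q → F) (u' v' : Q' → F) :
    (u ⬝ᵥ v) * (u' ⬝ᵥ v') = (fun q : Q × Q' => u q.1 * u' q.2) ⬝ᵥ fun q => v q.1 * v' q.2 := by
  simp only [dotProduct, Finset.sum_mul_sum, Fintype.sum_prod_type, mul_mul_mul_comm]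

namespace WeightedAutomaton

open scoped Matrix Kronecker

section Semiring

variable {F A Q Q' : Type*} [Semiring F] [Fintype Q] [DecidableEq Q] [Fintype Q'] [DecidableEq Q']

/-- The vector of the weights of `w` from each of the states. -/
def weightFrom (W : WeightedAutomaton F A Q) (w : List A) : Q → F :=
  W.wordTrans w *ᵥ W.final

@[simp]
theorem weightFrom_nil (W : WeightedAutomaton F A Q) : W.weightFrom [] = W.final := by
  simp [weightFrom, wordTrans]

@[simp]
theorem weightFrom_cons (W : WeightedAutomaton F A Q) (a : A) (w : List A) :
    W.weightFrom (a :: w) = W.trans a *ᵥ W.weightFrom w := by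
  simp [weightFrom, wordTrans]

theorem weight_eq_init_dotProduct_weightFrom (W : WeightedAutomaton F A Q) (w : List A) :
    W.weight w = W.init ⬝ᵥ W.weightFrom w :=
  rfl

/-- The automaton obtained by renaming the states along `e`. -/
def reindex (e : Q ≃ Q') (W : WeightedAutomaton F A Q) : WeightedAutomaton F A Q' where
  trans a := (W.trans a).submatrix e.symm e.symm
  init := W.init ∘ e.symm
  final := W.final ∘ e.symm

theorem weightFrom_reindex (e : Q ≃ Q') (W : WeightedAutomaton F A Q) (w : List A) :
    (W.reindex e).weightFrom w = W.weightFrom w ∘ e.symm := by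
  induction w with
  | nil => simp [reindex]
  | cons a w ih =>
    rw [weightFrom_cons, ih]
    simp [reindex, Matrix.submatrix_mulVec_equiv, Function.comp_assoc]

theorem weight_reindex (e : Q ≃ Q') (W : WeightedAutomaton F A Q) :
    (W.reindex e).weight = W.weight := by
  funext w
  rw [weight_eq_init_dotProduct_weightFrom, weightFrom_reindex]
  exact comp_equiv_dotProduct_comp_equiv _ _ e.symm

/-- The disjoint union of two automata, which computes the sum of their weight functions. -/
def disjointUnion (W : WeightedAutomaton F A Q) (W' : WeightedAutomaton F A Q') :
    WeightedAutomaton F A (Q ⊕ Q') where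
  trans a := Matrix.fromBlocks (W.trans a) 0 0 (W'.trans a)
  init := Sum.elim W.init W'.init
  final := Sum.elim W.final W'.final

theorem weightFrom_disjointUnion (W : WeightedAutomaton F A Q) (W' : WeightedAutomaton F A Q')
    (w : List A) :
    (W.disjointUnion W').weightFrom w = Sum.elim (W.weightFrom w) (W'.weightFrom w) := by
  induction w with
  | nil => simp [disjointUnion]
  | cons a w ih =>
    rw [weightFrom_cons, ih]
    simp [disjointUnion, Matrix.fromBlocks_mulVec]

theorem weight_disjointUnion (W : WeightedAutomaton F A Q) (W' : WeightedAutomaton F A Q') :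
    (W.disjointUnion W').weight = W.weight + W'.weight := by
  funext w
  rw [weight_eq_init_dotProduct_weightFrom, weightFrom_disjointUnion]
  exact sumElim_dotProduct_sumElim _ _ _ _

/-- The automaton that counts the letters of a word modulo `m` and returns the value of `g` at the
residue it ends with. -/
def cyclic (A : Type*) (m : ℕ) [NeZero m] (g : ZMod m → F) : WeightedAutomaton F A (ZMod m) where
  trans _ x y := if y = x + 1 then 1 else 0
  init := Pi.single 0 1
  final := g

theorem weightFrom_cyclic (m : ℕ) [NeZero m] (g : ZMod m → F) (w : List A) (x : ZMod m) :
    (cyclic A m g).weightFrom w x = g (x + w.length) := by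
  induction w generalizing x with
  | nil => simp [cyclic]
  | cons a w ih =>
    simp only [weightFrom_cons, Matrix.mulVec, dotProduct, ih]
    simp [cyclic, add_assoc, add_comm (1 : ZMod m)]

theorem weight_cyclic (m : ℕ) [NeZero m] (g : ZMod m → F) (w : List A) :
    (cyclic A m g).weight w = g w.length := by
  rw [weight_eq_init_dotProduct_weightFrom, cyclic, single_one_dotProduct]
  exact (weightFrom_cyclic m g w 0).trans (by rw [zero_add])

end Semiring

section CommSemiring

variable {F A Q Q' : Type*} [CommSemiring F] [Fintype Q] [DecidableEq Q] [Fintype Q']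
  [DecidableEq Q']

/-- The Kronecker product of two automata, which computes the pointwise (Hadamard) product of their
weight functions. -/
def kronecker (W : WeightedAutomaton F A Q) (W' : WeightedAutomaton F A Q') :
    WeightedAutomaton F A (Q × Q') where
  trans a := W.trans a ⊗ₖ W'.trans a
  init q := W.init q.1 * W'.init q.2
  final q := W.final q.1 * W'.final q.2

theorem weightFrom_kronecker (W : WeightedAutomaton F A Q) (W' : WeightedAutomaton F A Q')
    (w : List A) :
    (W.kronecker W').weightFrom w = fun q => W.weightFrom w q.1 * W'.weightFrom w q.2 := by
  induction w with
  | nil => simp [kronecker]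
  | cons a w ih =>
    funext q
    simp only [weightFrom_cons, ih]
    exact (dotProduct_mul_dotProduct _ _ _ _).symm

theorem weight_kronecker (W : WeightedAutomaton F A Q) (W' : WeightedAutomaton F A Q') :
    (W.kronecker W').weight = W.weight * W'.weight := by
  funext w
  rw [weight_eq_init_dotProduct_weightFrom, weightFrom_kronecker]
  exact (dotProduct_mul_dotProduct _ _ _ _).symm

end CommSemiring

end WeightedAutomaton

/-- The function `f` on words is the weight function of a weighted automaton with exactly `n`
states. -/
def IsRecognizable {F A : Type*} [Semiring F] (n : ℕ) (f : List A → F) : Prop :=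
  ∃ W : WeightedAutomaton F A (Fin n), W.weight = f

theorem WeightedAutomaton.isRecognizable {F A Q : Type*} [Semiring F] [Fintype Q] [DecidableEq Q]
    (W : WeightedAutomaton F A Q) : IsRecognizable (Fintype.card Q) W.weight :=
  ⟨W.reindex (Fintype.equivFin Q), W.weight_reindex _⟩

namespace IsRecognizable

section Semiring

variable {F A : Type*} [Semiring F] {n m : ℕ} {f g : List A → F}

theorem add (hf : IsRecognizable n f) (hg : IsRecognizable m g) :
    IsRecognizable (n + m) (f + g) := by
  obtain ⟨W, rfl⟩ := hf
  obtain ⟨W', rfl⟩ := hg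
  simpa [W.weight_disjointUnion] using (W.disjointUnion W').isRecognizable

theorem zero (n : ℕ) : IsRecognizable n (0 : List A → F) :=
  ⟨⟨0, 0, 0⟩, funext fun _ => zero_dotProduct _⟩

theorem mono (hf : IsRecognizable n f) (h : n ≤ m) : IsRecognizable m f := by
  obtain ⟨d, rfl⟩ := Nat.exists_eq_add_of_le h
  simpa using hf.add (zero d)

theorem const_mul (r : F) (hf : IsRecognizable n f) : IsRecognizable n (fun w => r * f w) := by
  obtain ⟨W, rfl⟩ := hf
  exact ⟨⟨W.trans, r • W.init, W.final⟩, funext fun _ => smul_dotProduct r _ _⟩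

theorem comp_length_natCast (A : Type*) [NeZero n] (g : ZMod n → F) :
    IsRecognizable n (fun w : List A => g w.length) := by
  have h := (WeightedAutomaton.cyclic A n g).isRecognizable
  rwa [ZMod.card, funext (WeightedAutomaton.weight_cyclic n g)] at h

theorem one : IsRecognizable 1 (1 : List A → F) :=
  comp_length_natCast A fun _ => 1

theorem ite_dvd_length (A : Type*) [NeZero n] (r s : F) :
    IsRecognizable n (fun w : List A => if n ∣ w.length then r else s) := by
  simpa only [ZMod.natCast_eq_zero_iff] using
    comp_length_natCast A fun x : ZMod n => if x = 0 then r else s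

end Semiring

theorem mul {F A : Type*} [CommSemiring F] {n m : ℕ} {f g : List A → F} (hf : IsRecognizable n f)
    (hg : IsRecognizable m g) : IsRecognizable (n * m) (f * g) := by
  obtain ⟨W, rfl⟩ := hf
  obtain ⟨W', rfl⟩ := hg
  simpa [W.weight_kronecker] using (W.kronecker W').isRecognizable

theorem sub {F A : Type*} [Ring F] {n m : ℕ} {f g : List A → F} (hf : IsRecognizable n f)
    (hg : IsRecognizable m g) : IsRecognizable (n + m) (f - g) := by
  have h := hf.add (hg.const_mul (-1))
  simp only [neg_one_mul] at h
  rwa [sub_eq_add_neg]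

end IsRecognizable

section AllEqual

variable {R : Type*} [CommRing R]

/-- The quadratic polynomial which on `0`-`1` inputs decides whether they are all equal. -/
def allEqual (x y z : R) : R :=
  1 - (x + y + z) + (x * y + y * z + z * x)

/-- The value at `x` of the complete ternary tree of height `k` with `allEqual` at the inner nodes
and `x 0, …, x (3 ^ k - 1)` at the leaves. -/
def allEqualTree : ℕ → (ℕ → R) → R
  | 0, x => x 0
  | k + 1, x => allEqualTree k fun i => allEqual (x (3 * i)) (x (3 * i + 1)) (x (3 * i + 2))

theorem allEqual_eq_zero_or_one {x y z : R} (hx : x = 0 ∨ x = 1) (hy : y = 0 ∨ y = 1)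
    (hz : z = 0 ∨ z = 1) : allEqual x y z = 0 ∨ allEqual x y z = 1 := by
  rcases hx with rfl | rfl <;> rcases hy with rfl | rfl <;> rcases hz with rfl | rfl <;>
    norm_num [allEqual]

theorem allEqualTree_eq_zero_or_one {x : ℕ → R} (hx : ∀ i, x i = 0 ∨ x i = 1) (k : ℕ) :
    allEqualTree k x = 0 ∨ allEqualTree k x = 1 := by
  induction k generalizing x with
  | zero => exact hx 0
  | succ _ ih => exact ih fun i => allEqual_eq_zero_or_one (hx _) (hx _) (hx _)

theorem allEqualTree_eq_one {k : ℕ} {x : ℕ → R} (hx : ∀ i < 3 ^ k, x i = 1) :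
    allEqualTree k x = 1 := by
  induction k generalizing x with
  | zero => exact hx 0 one_pos
  | succ k ih =>
    rw [pow_succ] at hx
    refine ih fun i hi => ?_
    rw [hx _ (by omega), hx _ (by omega), hx _ (by omega)]
    norm_num [allEqual]

theorem allEqualTree_eq_zero {k j : ℕ} (hj : j < 3 ^ k) {x : ℕ → R}
    (hx : ∀ i < 3 ^ k, x i = if i = j then 0 else 1) : allEqualTree k x = 0 := by
  induction k generalizing x j with
  | zero => simpa [allEqualTree, eq_comm, Nat.lt_one_iff.1 hj] using hx 0 one_pos
  | succ k ih =>
    rw [pow_succ] at hj hx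
    refine ih (j := j / 3) (by omega) fun i hi => ?_
    rw [hx _ (by omega), hx _ (by omega), hx _ (by omega)]
    have h_child : i = j / 3 ↔ 3 * i = j ∨ 3 * i + 1 = j ∨ 3 * i + 2 = j := by omega
    rw [if_congr h_child rfl rfl]
    split_ifs <;> first | omega | norm_num [allEqual]

end AllEqual

namespace IsRecognizable

variable {F A : Type*} [CommRing F] {B : ℕ}

theorem allEqual (hB : 0 < B) {f g h : List A → F} (hf : IsRecognizable B f)
    (hg : IsRecognizable B g) (hh : IsRecognizable B h) :
    IsRecognizable (7 * B ^ 2) (fun w => allEqual (f w) (g w) (h w)) := by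
  refine ((one.sub ((hf.add hg).add hh)).add
    (((hf.mul hg).add (hg.mul hh)).add (hh.mul hf))).mono ?_
  nlinarith

theorem allEqualTree {k : ℕ} (hB : 0 < B) {f : ℕ → List A → F}
    (hf : ∀ i < 3 ^ k, IsRecognizable B (f i)) :
    IsRecognizable ((7 * B) ^ 2 ^ k) (fun w => allEqualTree k fun i => f i w) := by
  induction k generalizing B f with
  | zero => exact (hf 0 one_pos).mono (by rw [pow_zero, pow_one]; omega)
  | succ k ih =>
    rw [pow_succ] at hf
    have h_leaves (i : ℕ) (hi : i < 3 ^ k) :=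
      allEqual hB (hf (3 * i) (by omega)) (hf (3 * i + 1) (by omega)) (hf (3 * i + 2) (by omega))
    have h_states : (7 * (7 * B ^ 2)) ^ 2 ^ k = (7 * B) ^ 2 ^ (k + 1) := by
      rw [pow_succ' 2 k, pow_mul]
      congr 1
      ring
    exact h_states ▸ ih (by positivity) h_leaves

end IsRecognizable

section NonDivisorTree

variable {F A : Type*} [CommRing F] {p : ℕ → ℕ} {k : ℕ}

/-- The weight function of words whose value at `w` is the tree of `allEqual` gates evaluated at
the indicators of `¬ p i ∣ w.length` for `i < 3 ^ k`. -/
def nonDivisorTree (F : Type*) {A : Type*} [CommRing F] (p : ℕ → ℕ) (k : ℕ) (w : List A) : F :=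
  allEqualTree k fun i => if p i ∣ w.length then 0 else 1

theorem nonDivisorTree_eq_zero_or_one (w : List A) :
    nonDivisorTree F p k w = 0 ∨ nonDivisorTree F p k w = 1 :=
  allEqualTree_eq_zero_or_one (fun _ => ite_eq_or_eq _ _ _) k

theorem nonDivisorTree_eq_one {w : List A} (h : ∀ i < 3 ^ k, ¬ p i ∣ w.length) :
    nonDivisorTree F p k w = 1 :=
  allEqualTree_eq_one fun i hi => if_neg (h i hi)

theorem nonDivisorTree_eq_zero {w : List A} {j : ℕ} (hj : j < 3 ^ k)
    (h : ∀ i < 3 ^ k, p i ∣ w.length ↔ i = j) : nonDivisorTree F p k w = 0 :=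
  allEqualTree_eq_zero hj fun i hi => if_congr (h i hi) rfl rfl

theorem isRecognizable_nonDivisorTree {B : ℕ} (hp : ∀ i < 3 ^ k, p i ≠ 0)
    (hB : ∀ i < 3 ^ k, p i ≤ B) :
    IsRecognizable ((7 * B) ^ 2 ^ k) (nonDivisorTree F p k : List A → F) := by
  have h_pos : 0 < 3 ^ k := by positivity
  refine IsRecognizable.allEqualTree ((Nat.pos_of_ne_zero (hp 0 h_pos)).trans_le (hB 0 h_pos))
    fun i hi => ?_
  have : NeZero (p i) := ⟨hp i hi⟩
  exact (IsRecognizable.ite_dvd_length A 0 1).mono (hB i hi)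

end NonDivisorTree

section Pumping

variable {A S : Type*} {N : NFA A S}

theorem exists_run_of_mem_evalFrom {s t : S} {x : List A} (h : t ∈ N.evalFrom {s} x) :
    ∃ r : ℕ → S, r 0 = s ∧ r x.length = t ∧
      ∀ i j, i ≤ j → j ≤ x.length → r j ∈ N.evalFrom {r i} ((x.take j).drop i) := by
  induction x generalizing s with
  | nil => exact ⟨fun _ => s, rfl, (by simpa using h.symm), by simp⟩
  | cons a x ih =>
    rw [NFA.evalFrom_cons, NFA.stepSet_singleton, NFA.mem_evalFrom_iff_exists] at h
    obtain ⟨_, hs, h⟩ := h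
    obtain ⟨r, rfl, h_last, hr⟩ := ih h
    refine ⟨fun | 0 => s | i + 1 => r i, rfl, h_last, ?_⟩
    rintro (_ | i) (_ | j) hij hj
    · simp
    · have h_tail := hr 0 j j.zero_le (by simpa using hj)
      rw [List.drop_zero] at h_tail
      simpa using NFA.mem_evalFrom_iff_exists.2 ⟨r 0, hs, h_tail⟩
    · omega
    · simpa using hr i j (by omega) (by simpa using hj)

variable [Fintype S]

theorem exists_loop_of_mem_evalFrom {s t : S} {x : List A} (h : t ∈ N.evalFrom {s} x)
    (hx : Fintype.card S ≤ x.length) :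
    ∃ q u v w, x = u ++ v ++ w ∧ u.length + v.length ≤ Fintype.card S ∧ v ≠ [] ∧
      q ∈ N.evalFrom {s} u ∧ q ∈ N.evalFrom {q} v ∧ t ∈ N.evalFrom {q} w := by
  obtain ⟨r, rfl, rfl, hr⟩ := exists_run_of_mem_evalFrom h
  obtain ⟨i, j, h_ne, h_eq⟩ := Fintype.exists_ne_map_eq_of_card_lt
    (fun i : Fin (Fintype.card S + 1) => r i) (by simp)
  wlog hij : i < j generalizing i j
  · exact this j i h_ne.symm h_eq.symm (h_ne.lt_or_gt.resolve_left hij)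
  have hij' : (i : ℕ) < j := hij
  have h_first := hr 0 i (by omega) (by omega)
  have h_loop := hr i j (by omega) (by omega)
  have h_last := hr j x.length (by omega) le_rfl
  rw [List.drop_zero] at h_first
  rw [← h_eq] at h_loop h_last
  rw [List.take_length] at h_last
  refine ⟨r i, x.take i, (x.take j).drop i, x.drop j, ?_, ?_, ?_, h_first, h_loop, h_last⟩
  · have h_take : x.take i = (x.take j).take i := by rw [List.take_take, min_eq_left hij'.le]
    rw [h_take, List.take_append_drop, List.take_append_drop]
  · simp only [List.length_take, List.length_drop]
    omega
  · rw [← List.length_pos_iff, List.length_drop, List.length_take]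
    omega

/-- Unlike `NFA.pumping_lemma`, which goes through the subset construction, this bounds the pumped
part by the number of states of the automaton itself. -/
theorem exists_append_flatten_replicate_mem_accepts {x : List A} (h : x ∈ N.accepts)
    (hx : Fintype.card S ≤ x.length) :
    ∃ u v w, x = u ++ v ++ w ∧ u.length + v.length ≤ Fintype.card S ∧ v ≠ [] ∧
      ∀ m, u ++ (List.replicate m v).flatten ++ w ∈ N.accepts := by
  obtain ⟨t, ht, h_run⟩ := NFA.mem_accepts.1 h
  obtain ⟨s, hs, h_run⟩ := NFA.mem_evalFrom_iff_exists.1 h_run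
  obtain ⟨q, u, v, w, h_split, h_card, hv, h_first, h_loop, h_last⟩ :=
    exists_loop_of_mem_evalFrom h_run hx
  have h_pump (m : ℕ) : q ∈ N.evalFrom {q} (List.replicate m v).flatten := by
    induction m with
    | zero => simp
    | succ m ih =>
      rw [List.replicate_succ, List.flatten_cons, NFA.evalFrom_append]
      exact NFA.mem_evalFrom_iff_exists.2 ⟨q, h_loop, ih⟩
  refine ⟨u, v, w, h_split, h_card, hv, fun m => NFA.mem_accepts.2 ⟨t, ht, ?_⟩⟩
  rw [NFA.evalFrom_append, NFA.evalFrom_append]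
  have h_u : q ∈ N.evalFrom N.start u := NFA.mem_evalFrom_iff_exists.2 ⟨s, hs, h_first⟩
  exact NFA.mem_evalFrom_iff_exists.2 ⟨q, NFA.mem_evalFrom_iff_exists.2 ⟨q, h_u, h_pump m⟩, h_last⟩

theorem exists_replicate_add_mul_mem_accepts {a : A} {t : ℕ}
    (h : List.replicate t a ∈ N.accepts) (ht : Fintype.card S ≤ t) :
    ∃ l, 0 < l ∧ l ≤ Fintype.card S ∧ ∀ m, List.replicate (t + m * l) a ∈ N.accepts := by
  obtain ⟨u, v, w, h_split, h_card, hv, h_pump⟩ :=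
    exists_append_flatten_replicate_mem_accepts h (by simpa using ht)
  refine ⟨v.length, List.length_pos_iff.2 hv, by omega, fun m => ?_⟩
  obtain ⟨h_len, h_uv, hw⟩ := List.append_eq_replicate_iff.1 h_split.symm
  obtain ⟨-, hu, hv⟩ := List.append_eq_replicate_iff.1 h_uv
  have h_word : List.replicate (t + m * v.length) a =
      u ++ (List.replicate (m + 1) v).flatten ++ w := by
    rw [hu, hv, hw]
    simp only [List.length_replicate, List.flatten_replicate_replicate,
      List.replicate_append_replicate]
    congr 1
    rw [List.length_append] at h_len
    linarith
  exact h_word ▸ h_pump (m + 1)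

end Pumping

section Primes

theorem exists_dvd_add_mul_of_coprime {l q : ℕ} (h : Nat.Coprime l q) (hq : q ≠ 0) (t : ℕ) :
    ∃ m, q ∣ t + m * l := by
  obtain ⟨m, -, hm⟩ := Nat.exists_mul_mod_eq_of_coprime ((q - 1) * t) h hq
  refine ⟨m, ?_⟩
  have h_cong : t + m * l ≡ t + (q - 1) * t [MOD q] :=
    (mul_comm l m ▸ hm : _ ≡ _ [MOD q]).add_left t
  have h_mul : t + (q - 1) * t = q * t := by
    rw [← one_add_mul, Nat.add_sub_cancel' (Nat.one_le_iff_ne_zero.2 hq)]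
  exact (h_cong.dvd_iff dvd_rfl).2 (h_mul ▸ dvd_mul_right q t)

variable {ι : Type*} {s : Finset ι} {p : ι → ℕ}

theorem exists_forall_dvd_add_mul_iff_eq (hp : ∀ i ∈ s, (p i).Prime) (hinj : Set.InjOn p s)
    {t l : ℕ} (ht : ∀ i ∈ s, ¬ p i ∣ t) {j : ι} (hj : j ∈ s) (hl : ¬ p j ∣ l) :
    ∃ m, ∀ i ∈ s, p i ∣ t + m * l ↔ i = j := by
  classical
  set r := ∏ i ∈ s.erase j, p i
  have h_coprime : Nat.Coprime (r * l) (p j) := by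
    refine Nat.Coprime.mul_left (Nat.Coprime.prod_left fun i hi => ?_)
      ((hp j hj).coprime_iff_not_dvd.2 hl).symm
    have hi := Finset.mem_erase.1 hi
    exact (Nat.coprime_primes (hp i hi.2) (hp j hj)).2 (hinj.ne hi.2 hj hi.1)
  obtain ⟨m, hm⟩ := exists_dvd_add_mul_of_coprime h_coprime (hp j hj).ne_zero t
  rw [← mul_assoc] at hm
  refine ⟨m * r, fun i hi => ⟨fun h_dvd => ?_, fun hij => hij ▸ hm⟩⟩
  by_contra hij
  have h_dvd_r : p i ∣ r := Finset.dvd_prod_of_mem p (Finset.mem_erase.2 ⟨hij, hi⟩)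
  exact ht i hi ((Nat.dvd_add_left ((h_dvd_r.mul_left m).mul_right l)).1 h_dvd)

theorem prod_le_card_of_forall_replicate {A S : Type*} [Fintype S] {N : NFA A S} {a : A}
    (hp : ∀ i ∈ s, (p i).Prime) (hinj : Set.InjOn p s)
    (h_mem : ∀ t, (∀ i ∈ s, ¬ p i ∣ t) → List.replicate t a ∈ N.accepts)
    (h_notMem : ∀ t, ∀ j ∈ s, (∀ i ∈ s, p i ∣ t ↔ i = j) → List.replicate t a ∉ N.accepts) :
    ∏ i ∈ s, p i ≤ Fintype.card S := by
  set r := ∏ i ∈ s, p i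
  have hr : 0 < r := Finset.prod_pos fun i hi => (hp i hi).pos
  have h_one_add (i : ι) (hi : i ∈ s) : ¬ p i ∣ 1 + r * Fintype.card S := fun h_dvd =>
    (hp i hi).not_dvd_one
      ((Nat.dvd_add_left ((Finset.dvd_prod_of_mem p hi).mul_right _)).1 h_dvd)
  obtain ⟨l, hl_pos, hl_le, h_pump⟩ :=
    exists_replicate_add_mul_mem_accepts (h_mem _ h_one_add) (by nlinarith)
  have h_dvd (j : ι) (hj : j ∈ s) : p j ∣ l := by
    by_contra hl
    obtain ⟨m, hm⟩ := exists_forall_dvd_add_mul_iff_eq hp hinj h_one_add hj hl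
    exact h_notMem _ j hj hm (h_pump m)
  have h_prod_dvd : r ∣ l := Finset.prod_dvd_of_isRelPrime (fun i hi j hj hij =>
    Nat.coprime_iff_isRelPrime.1 ((Nat.coprime_primes (hp i hi) (hp j hj)).2 (hinj.ne hi hj hij)))
    h_dvd
  exact (Nat.le_of_dvd hl_pos h_prod_dvd).trans hl_le

end Primes

theorem exists_isImageBinary_forall_prod_le_card (F A : Type*) [CommRing F] [Nontrivial F]
    [Nonempty A] {p : ℕ → ℕ} {k B n : ℕ} (hp : ∀ i < 3 ^ k, (p i).Prime)
    (hinj : Function.Injective p) (hB : ∀ i < 3 ^ k, p i ≤ B) (hn : (7 * B) ^ 2 ^ k ≤ n) :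
    ∃ W : WeightedAutomaton F A (Fin n), W.IsImageBinary ∧
      ∀ (S : Type*) [Fintype S] (N : NFA A S),
        N.accepts = W.accepts → ∏ i ∈ Finset.range (3 ^ k), p i ≤ Fintype.card S := by
  obtain ⟨W, hW⟩ := (isRecognizable_nonDivisorTree (F := F) (A := A)
    (fun i hi => (hp i hi).ne_zero) hB).mono hn
  refine ⟨W, fun w => hW ▸ nonDivisorTree_eq_zero_or_one w, fun S _ N hN => ?_⟩
  have h_mem_iff (w : List A) : w ∈ N.accepts ↔ nonDivisorTree F p k w = 1 := by
    rw [hN, ← hW]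
    rfl
  obtain ⟨a⟩ := ‹Nonempty A›
  refine prod_le_card_of_forall_replicate (N := N) (a := a) ?_ hinj.injOn ?_ ?_ <;>
    simp only [Finset.mem_range, h_mem_iff]
  · exact hp
  · exact fun t ht => nonDivisorTree_eq_one (by simpa using ht)
  · intro t j hj ht
    rw [nonDivisorTree_eq_zero hj (by simpa using ht)]
    exact zero_ne_one

theorem exists_injective_primes_between {P : ℕ} (hP : 0 < P) :
    ∃ p : ℕ → ℕ, Function.Injective p ∧
      ∀ i, (p i).Prime ∧ P < p i ∧ p i ≤ 2 ^ (i + 1) * P := by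
  choose p hp hlt hle using fun i : ℕ =>
    Nat.exists_prime_lt_and_le_two_mul (2 ^ i * P) (by positivity)
  have hle' (i : ℕ) : p i ≤ 2 ^ (i + 1) * P := (hle i).trans_eq (by ring)
  have h_strictMono : StrictMono p :=
    strictMono_nat_of_lt_succ fun i => (hle' i).trans_lt (hlt (i + 1))
  exact ⟨p, h_strictMono.injective, fun i =>
    ⟨hp i, (Nat.le_mul_of_pos_left P (by positivity)).trans_lt (hlt i), hle' i⟩⟩

theorem exists_mul_two_pow_lt_three_pow (c : ℕ) : ∃ k, c * 2 ^ k < 3 ^ k := by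
  obtain ⟨k, hk⟩ := pow_unbounded_of_one_lt (c : ℚ) (by norm_num : (1 : ℚ) < 3 / 2)
  refine ⟨k, ?_⟩
  rw [div_pow, lt_div_iff₀ (by positivity)] at hk
  exact_mod_cast hk

theorem exists_mul_pow_le_and_pow_le_pow {K d : ℕ} (hK : 0 < K) (hd : d ≠ 0) (c : ℕ) :
    ∃ n₀, ∀ n, n₀ ≤ n → ∃ P, 0 < P ∧ K * P ^ d ≤ n ∧ n ^ c ≤ P ^ (c * d + 1) := by
  set P₀ := (K * 2 ^ d) ^ c
  have hP₀ : 0 < P₀ := by positivity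
  refine ⟨P₀ ^ d * K, fun n hn => ?_⟩
  set P := Nat.nthRoot d (n / K)
  have h_P₀_le : P₀ ≤ P := (Nat.le_nthRoot_iff hd).2 ((Nat.le_div_iff_mul_le hK).2 hn)
  have h_le : P ^ d * K ≤ n :=
    (Nat.le_div_iff_mul_le hK).1 ((Nat.le_nthRoot_iff hd).1 le_rfl)
  have h_lt : n < (P + 1) ^ d * K :=
    (Nat.div_lt_iff_lt_mul hK).1 (Nat.lt_pow_nthRoot_add_one hd _)
  have hP : 0 < P := hP₀.trans_le h_P₀_le
  refine ⟨P, hP, mul_comm K _ ▸ h_le, ?_⟩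
  calc n ^ c ≤ ((P + 1) ^ d * K) ^ c := by gcongr
    _ ≤ ((2 * P) ^ d * K) ^ c := by gcongr; omega
    _ = P₀ * P ^ (c * d) := by rw [mul_comm c d, pow_mul, ← mul_pow]; ring
    _ ≤ P * P ^ (c * d) := by gcongr
    _ = P ^ (c * d + 1) := (pow_succ' P _).symm

theorem mainTheorem12_general (F A : Type*) [CommRing F] [Nontrivial F] [Nonempty A] :
    ∀ c : ℕ, ∃ n₀ : ℕ, ∀ n : ℕ, n₀ ≤ n →
      ∃ W : WeightedAutomaton F A (Fin n), W.IsImageBinary ∧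
        ∀ (S : Type*) [Fintype S] (N : NFA A S),
          N.accepts = W.accepts → n ^ c < Fintype.card S := by
  intro c
  obtain ⟨k, hk⟩ := exists_mul_two_pow_lt_three_pow c
  obtain ⟨n₀, hn₀⟩ := exists_mul_pow_le_and_pow_le_pow
    (K := (7 * 2 ^ 3 ^ k) ^ 2 ^ k) (d := 2 ^ k) (by positivity) (by positivity) c
  refine ⟨n₀, fun n hn => ?_⟩
  obtain ⟨P, hP, hPn, hnP⟩ := hn₀ n hn
  obtain ⟨p, hinj, hp⟩ := exists_injective_primes_between hP
  have hpB (i : ℕ) (hi : i < 3 ^ k) : p i ≤ 2 ^ 3 ^ k * P :=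
    (hp i).2.2.trans (by gcongr; exacts [one_le_two, hi])
  obtain ⟨W, hW, hcard⟩ := exists_isImageBinary_forall_prod_le_card F A (n := n)
    (fun i _ => (hp i).1) hinj hpB (by rwa [← mul_assoc, mul_pow])
  refine ⟨W, hW, fun S _ N hN => ?_⟩
  calc n ^ c ≤ P ^ (c * 2 ^ k + 1) := hnP
    _ ≤ P ^ 3 ^ k := Nat.pow_le_pow_right hP hk
    _ = ∏ _i ∈ Finset.range (3 ^ k), P := by rw [Finset.prod_const, Finset.card_range]
    _ < ∏ i ∈ Finset.range (3 ^ k), p i :=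
        Finset.prod_lt_prod_of_nonempty (fun _ _ => hP) (fun i _ => (hp i).2.1)
          (Finset.nonempty_range_iff.2 (by positivity))
    _ ≤ Fintype.card S := hcard S N hN

/-- Converting image-binary finite automata (over the rationals) to nondeterministic finite
automata requires a super-polynomial state blowup, over every nonempty finite alphabet (in
particular over a one-letter alphabet). -/
theorem mainTheorem12 (A : Type*) [Fintype A] [Nonempty A] :
    ∀ c : ℕ, ∃ n₀ : ℕ, ∀ n : ℕ, n₀ ≤ n →
      ∃ W : WeightedAutomaton ℚ A (Fin n), W.IsImageBinary ∧
        ∀ (S : Type*) [Fintype S] (N : NFA A S),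
          N.accepts = W.accepts → n ^ c < Fintype.card S :=
  mainTheorem12_general ℚ A
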